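/- **Setting.** Let $Q$ be a smooth finite-dimensional manifold and let $B$ be a Poisson tensor on $T^*Q$, with bracket $\{f,g\}=B(\mathrm df,\mathrm dg)$ and bundle map $B^\sharp:T^*T^*Q\to TT^*Q$, $B(\alpha,\beta)=\langle\alpha,B^\sharp\beta\rangle$. A CH system $(T^*Q,B,H,F,W)$ consists of $B$, a smooth Hamiltonian $H:T^*Q\to\mathbb R$, a smooth fiber-preserving force map $F:T^*Q\to T^*Q$, and a control subset $W\subset T^*Q$, an embedded submanifold (with the relative topology) for which $W\to Q$ is a surjective submersion. Fix a smooth splitting of $TT^*Q$ into the vertical bundle and a horizontal bundle. With $X_H=B^\sharp\mathrm dH$, the dynamical vector field of a control law, i.e. a smooth fiber-preserving map $u:T^*Q\to W$, is $X_u=X_H+\mathrm{vlift}(F)X_H+\mathrm{vlift}(u)X_H$, where $\mathrm{vlift}(\varphi)X_H(\alpha)$ is the vertical part of $T\varphi(X_H(\alpha))$ translated along the fiber from $\varphi(\alpha)$ to $\alpha$. $W$ is a *controllability submanifold* if (provided control laws exist) any two states $x_0,x_1\in T^*Q$ are joined by a curve $x:[0,1]\to T^*Q$ consisting of finitely many pieces,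 each of which is an integral curve of $X_u$ for some control law $u$. Let $D\subset TT^*Q|_W$ be a generalized distribution (a linear subspace $D(w)\subset T_wT^*Q$ for each $w\in W$) and $D_W=D\cap TW$. $D_W$ is *smooth* if each of its vectors extends to a smooth local section of $D_W$, *regular* if its rank is locally constant, and *integrable* if through each point of $W$ passes a connected immersed submanifold of $W$ whose tangent spaces are the fibers of $D_W$. $D$ is *Poisson* if for all open $U\subset T^*Q$ and $f,g\in C^\infty(U)$ whose differentials vanish on $D$ at the points of $U\cap W$, the differential of $\{f,g\}$ vanishes on $D$ at the points of $U\cap W$. $D$ is a *controllability distribution* if $W$ is a controllability submanifold, $D$ is Poisson, and $D_W$ is smooth and integrable. Let $\pi:W\to W/D_W$ be the projection to the space of leaves of $D_W$ (two points lie on the same leaf if they are joined by finitely many integral curves of local sections of $D_W$), with the quotient topology. A subset of $W$ is $D_W$-invariant if it is invariant under the flows of local sections of $D_W$. For $V\subset W/D_W$ open, a *local extension* at $m\in\pi^{-1}(V)$ of $f\circ\pi$, $f:V\to\mathbb R$, is a function $K\in C^\infty(U_m)$ on an open neighborhood $U_m$ of $m$ in $T^*Q$ such that $U_m\cap W$ is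 $D_W$-invariant and $f\circ\pi=K$ on $\pi^{-1}(V)\cap U_m$; it is *$D$-invariant* if $\mathrm dK(y)|_{D(y)}=0$ for all $y\in\pi^{-1}(V)\cap U_m$. $C^\infty_{W/D_W}(V)$ is the algebra of all $f:V\to\mathbb R$ such that for each $z\in V$ there is a local extension of $f\circ\pi$ at some $m\in\pi^{-1}(z)$. The presheaf $C^\infty_{W/D_W}$ has the *$(D,D_W)$-local extension property* if these local extensions can always be chosen $D$-invariant. The CH system is *Poisson reducible by $D$* if there are brackets $\{\cdot,\cdot\}_V$ on $C^\infty_{W/D_W}(V)$, $V\subset W/D_W$ open, making $C^\infty_{W/D_W}$ a presheaf of Poisson algebras, with $$\{f,h\}_V(\pi(m))=\{K,L\}(m)$$ for all $m\in\pi^{-1}(V)$ and all local $D$-invariant extensions $K,L\in C^\infty(U_m)$ of $f\circ\pi$, $h\circ\pi$ at $m$. **Theorem 3.4.** Let $(T^*Q,B,H,F,W)$ be a CH system, $W$ its controllability submanifold and $D\subset TT^*Q|_W$ a controllability distribution such that $D_W=D\cap TW$ is smooth, regular and integrable and the presheaf $C^\infty_{W/D_W}$ has the $(D,D_W)$-local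 extension property. Then the CH system is Poisson reducible by $D$ if and only if $$B^\sharp(\Delta_z)\subset(\Delta_z)_W^\circ\qquad\text{for all } z\in W,$$ where $\Delta_z\subset T_z^*T^*Q$ is the set of all $\mathrm df(z)$ with $f\in C^\infty(U_z)$, $U_z$ an open neighborhood of $z$ in $T^*Q$, and $\mathrm df(y)|_{D(y)}=0$ for all $y\in U_z\cap W$; where $(\Delta_z)_W\subset\Delta_z$ consists of those $\mathrm df(z)$ for which moreover $f|_{U_z\cap W}$ is constant; and where $(\Delta_z)_W^\circ=\{v\in T_zT^*Q\mid \langle\beta,v\rangle=0\ \text{for all }\beta\in(\Delta_z)_W\}$. -/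

import Mathlib

open Set Topology TopologicalSpace
open scoped Manifold ContDiff Bundle

namespace PoissonReduction

noncomputable section

/-! ### Poisson manifolds -/

section Poisson

variable {EP HP P : Type*} [NormedAddCommGroup EP] [NormedSpace ℝ EP]
  [TopologicalSpace HP] (J : ModelWithCorners ℝ EP HP)
  [TopologicalSpace P] [ChartedSpace HP P]

/-- A Poisson tensor `B` on `P`, recorded through its bundle map `B♯ : T*P → TP`, where
`B(α, β) = ⟨α, B♯ β⟩`. The bracket `{f, g} = B(df, dg) = df (B♯ dg)` of smooth functions is smooth,
antisymmetric and satisfies the Jacobi identity; being a biderivation is automatic. -/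
structure PoissonTensor (P : Type*) [TopologicalSpace P] [ChartedSpace HP P] where
  /-- The bundle map `B♯`. -/
  sharp : ∀ x : P, (TangentSpace J x →L[ℝ] ℝ) →ₗ[ℝ] TangentSpace J x
  antisymm : ∀ (x : P) (α β : TangentSpace J x →L[ℝ] ℝ), α (sharp x β) = -β (sharp x α)
  smooth : ∀ (U : Set P), IsOpen U → ∀ f g : P → ℝ,
    ContMDiffOn J 𝓘(ℝ, ℝ) ∞ f U → ContMDiffOn J 𝓘(ℝ, ℝ) ∞ g U →
    ContMDiffOn J 𝓘(ℝ, ℝ) ∞ (fun x => mvfderiv J f x (sharp x (mvfderiv J g x))) U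
  jacobi : ∀ (U : Set P), IsOpen U → ∀ f g h : P → ℝ,
    ContMDiffOn J 𝓘(ℝ, ℝ) ∞ f U → ContMDiffOn J 𝓘(ℝ, ℝ) ∞ g U →
    ContMDiffOn J 𝓘(ℝ, ℝ) ∞ h U → ∀ x ∈ U,
    mvfderiv J f x (sharp x
        (mvfderiv J (fun y => mvfderiv J g y (sharp y (mvfderiv J h y))) x)) +
      mvfderiv J g x (sharp x
        (mvfderiv J (fun y => mvfderiv J h y (sharp y (mvfderiv J f y))) x)) +
      mvfderiv J h x (sharp x
        (mvfderiv J (fun y => mvfderiv J f y (sharp y (mvfderiv J g y))) x)) = 0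

variable {J}

/-- The Poisson bracket `{f, g}(x) = B(x)(df(x), dg(x))`. -/
def PoissonTensor.bracket (B : PoissonTensor J P) (f g : P → ℝ) (x : P) : ℝ :=
  mvfderiv J f x (B.sharp x (mvfderiv J g x))

end Poisson

/-! ### Distributions on a manifold -/

section Distribution

variable {E' S : Type*} [NormedAddCommGroup E'] [NormedSpace ℝ E']
  [TopologicalSpace S] [ChartedSpace E' S] [IsManifold 𝓘(ℝ, E') ∞ S]

/-- `X` is a smooth section of the generalized distribution `Δ`, defined on the open set `O`. -/
structure IsLocalSection (Δ : ∀ y : S, Submodule ℝ (TangentSpace 𝓘(ℝ, E') y))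
    (O : Set S) (X : ∀ y : S, TangentSpace 𝓘(ℝ, E') y) : Prop where
  isOpen : IsOpen O
  smooth : ContMDiffOn 𝓘(ℝ, E') 𝓘(ℝ, E').tangent ∞
    (fun y => (⟨y, X y⟩ : TangentBundle 𝓘(ℝ, E') S)) O
  mem : ∀ y ∈ O, X y ∈ Δ y

/-- The distribution is smooth: each of its vectors extends to a smooth local section. -/
def IsSmoothDistribution (Δ : ∀ y : S, Submodule ℝ (TangentSpace 𝓘(ℝ, E') y)) : Prop :=
  ∀ y, ∀ v ∈ Δ y, ∃ O X, IsLocalSection Δ O X ∧ y ∈ O ∧ X y = v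

/-- The distribution is regular: its rank is locally constant. -/
def IsRegularDistribution (Δ : ∀ y : S, Submodule ℝ (TangentSpace 𝓘(ℝ, E') y)) : Prop :=
  ∀ y, ∀ᶠ y' in 𝓝 y, Module.finrank ℝ (Δ y') = Module.finrank ℝ (Δ y)

/-- The distribution is completely integrable: through each point there passes a connected
injectively immersed submanifold `j : N → S` whose tangent space at each of its points is the
fibre of the distribution. -/
def IsIntegrableDistribution (Δ : ∀ y : S, Submodule ℝ (TangentSpace 𝓘(ℝ, E') y)) : Prop :=
  ∀ y : S, ∃ (k : ℕ) (N : Type) (_ : TopologicalSpace N)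
    (_ : ChartedSpace (EuclideanSpace ℝ (Fin k)) N)
    (_ : IsManifold 𝓘(ℝ, EuclideanSpace ℝ (Fin k)) ∞ N) (_ : ConnectedSpace N) (j : N → S),
    ContMDiff 𝓘(ℝ, EuclideanSpace ℝ (Fin k)) 𝓘(ℝ, E') ∞ j ∧ Function.Injective j ∧
    y ∈ range j ∧
    ∀ p, Function.Injective (mfderiv 𝓘(ℝ, EuclideanSpace ℝ (Fin k)) 𝓘(ℝ, E') j p) ∧
      range (mfderiv 𝓘(ℝ, EuclideanSpace ℝ (Fin k)) 𝓘(ℝ, E') j p) = (Δ (j p) : Set _)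

/-- The flow of some local section of `Δ` takes `x` to `y`. -/
def FlowStep (Δ : ∀ y : S, Submodule ℝ (TangentSpace 𝓘(ℝ, E') y)) (x y : S) : Prop :=
  ∃ (O : Set S) (X : ∀ y : S, TangentSpace 𝓘(ℝ, E') y) (γ : ℝ → S) (a b : ℝ),
    IsLocalSection Δ O X ∧ a ≤ b ∧ IsMIntegralCurveOn (I := 𝓘(ℝ, E')) γ X (Icc a b) ∧
    MapsTo γ (Icc a b) O ∧ γ a = x ∧ γ b = y

/-- A subset is invariant if it is invariant under the flow of every local section. -/
def IsInvariantSet (Δ : ∀ y : S, Submodule ℝ (TangentSpace 𝓘(ℝ, E') y)) (A : Set S) : Prop :=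
  ∀ x y, FlowStep Δ x y → x ∈ A → y ∈ A

/-- Two points are equivalent if they lie on the same accessible set (maximal integral manifold)
of `Δ`, i.e. are joined by a finite union of integral curves of local sections. -/
def leafSetoid (Δ : ∀ y : S, Submodule ℝ (TangentSpace 𝓘(ℝ, E') y)) : Setoid S :=
  Relation.EqvGen.setoid (FlowStep Δ)

/-- The leaf space, with the quotient topology. -/
abbrev LeafSpace (Δ : ∀ y : S, Submodule ℝ (TangentSpace 𝓘(ℝ, E') y)) : Type _ :=
  Quotient (leafSetoid Δ)

/-- The projection to the leaf space. -/
def leafProj (Δ : ∀ y : S, Submodule ℝ (TangentSpace 𝓘(ℝ, E') y)) (x : S) : LeafSpace Δ :=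
  Quotient.mk (leafSetoid Δ) x

theorem isLocalSection_neg {Δ : ∀ y : S, Submodule ℝ (TangentSpace 𝓘(ℝ, E') y)} {O : Set S}
    {X : ∀ y : S, TangentSpace 𝓘(ℝ, E') y}
    (h : IsLocalSection Δ O X) : IsLocalSection Δ O (-X) := by
  refine ⟨h.isOpen, ?_, fun y hy => (Δ y).neg_mem (h.mem y hy)⟩
  exact ContMDiffOn.neg_section h.smooth

theorem flowStep_symm {Δ : ∀ y : S, Submodule ℝ (TangentSpace 𝓘(ℝ, E') y)}
    {x y : S} (h : FlowStep Δ x y) : FlowStep Δ y x := by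
  obtain ⟨O, X, γ, a, b, hX, hab, hγ, hO, hx, hy⟩ := h
  refine ⟨O, -X, γ ∘ (fun t => t * (-1)), -b, -a, isLocalSection_neg hX, by linarith, ?_, ?_,
    by simpa using hy, by simpa using hx⟩
  · have := hγ.comp_mul (-1)
    convert this using 1
    · simp
    · ext t; simp only [mem_Icc, mem_ofPred_eq]; constructor <;> rintro ⟨h1, h2⟩ <;>
        constructor <;> linarith
  · intro t ht
    apply hO
    simp only [mem_Icc] at ht ⊢
    constructor <;> linarith

/-- An invariant set is a union of leaves. -/
theorem IsInvariantSet.mem_iff {Δ : ∀ y : S, Submodule ℝ (TangentSpace 𝓘(ℝ, E') y)}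
    {A : Set S} (hA : IsInvariantSet Δ A) {x y : S}
    (h : leafProj Δ x = leafProj Δ y) : x ∈ A ↔ y ∈ A := by
  have h' : Relation.EqvGen (FlowStep Δ) x y := Quotient.exact h
  clear h
  induction h' with
  | rel x y h => exact ⟨hA x y h, hA y x (flowStep_symm h)⟩
  | refl x => exact Iff.rfl
  | symm x y _ ih => exact ih.symm
  | trans x y z _ _ ih1 ih2 => exact ih1.trans ih2

end Distribution

/-! ### Reduction of a Poisson manifold by a distribution along a submanifold

Throughout, `ι : S → P` is the inclusion of a submanifold and `D ⊂ TP|_S` is a generalized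
distribution along `S`, given by its fibres `D s ⊂ T_{ι s} P`. -/

section Reduction

variable {EP HP P : Type*} [NormedAddCommGroup EP] [NormedSpace ℝ EP]
  [TopologicalSpace HP] {J : ModelWithCorners ℝ EP HP}
  [TopologicalSpace P] [ChartedSpace HP P]
  {E' S : Type*} [NormedAddCommGroup E'] [NormedSpace ℝ E']
  [TopologicalSpace S] [ChartedSpace E' S] [IsManifold 𝓘(ℝ, E') ∞ S]

/-- `ι` exhibits `S` as an embedded submanifold of `P` (with the relative topology). -/
structure IsEmbeddedSubmanifold (J : ModelWithCorners ℝ EP HP) (ι : S → P) : Prop where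
  isEmbedding : IsEmbedding ι
  smooth : ContMDiff 𝓘(ℝ, E') J ∞ ι
  immersion : ∀ s, Function.Injective (mfderiv 𝓘(ℝ, E') J ι s)

/-- `D_S = D ∩ TS`, as a generalized distribution on `S`. -/
def tangentPart (ι : S → P) (D : ∀ s : S, Submodule ℝ (TangentSpace J (ι s))) (s : S) :
    Submodule ℝ (TangentSpace 𝓘(ℝ, E') s) :=
  (D s).comap (mfderiv 𝓘(ℝ, E') J ι s).toLinearMap

/-- `df` vanishes on `D` at all points of `S ∩ U`. -/
def KillsOn (ι : S → P) (D : ∀ s : S, Submodule ℝ (TangentSpace J (ι s)))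
    (f : P → ℝ) (U : Set P) : Prop :=
  ∀ s, ι s ∈ U → ∀ v ∈ D s, mvfderiv J f (ι s) v = 0

/-- `D` is Poisson (canonical): if `df` and `dg` vanish on `D`, then so does `d{f, g}`. -/
def IsPoissonDistribution (B : PoissonTensor J P) (ι : S → P)
    (D : ∀ s : S, Submodule ℝ (TangentSpace J (ι s))) : Prop :=
  ∀ U : Set P, IsOpen U → ∀ f g : P → ℝ,
    ContMDiffOn J 𝓘(ℝ, ℝ) ∞ f U → ContMDiffOn J 𝓘(ℝ, ℝ) ∞ g U →
    KillsOn ι D f U → KillsOn ι D g U → KillsOn ι D (B.bracket f g) U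

/-- `F`, smooth on the open neighbourhood `U` of `m` in `P` for which `U ∩ S` is `D_S`-invariant,
is a local extension at `m` of `f ∘ π`, where `f` is a function on the open subset `V` of
`S / D_S`. -/
structure IsLocalExtension (ι : S → P) (D : ∀ s : S, Submodule ℝ (TangentSpace J (ι s)))
    (V : Opens (LeafSpace (tangentPart (E' := E') ι D))) (f : V → ℝ)
    (m : S) (U : Set P) (F : P → ℝ) : Prop where
  isOpen : IsOpen U
  mem : ι m ∈ U
  invariant : IsInvariantSet (tangentPart (E' := E') ι D) (ι ⁻¹' U)
  smooth : ContMDiffOn J 𝓘(ℝ, ℝ) ∞ F U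
  eq : ∀ (s : S) (hs : leafProj (tangentPart (E' := E') ι D) s ∈ V), ι s ∈ U → f ⟨_, hs⟩ = F (ι s)

/-- `F` is a local `D`-invariant extension of `f ∘ π` at `m`: moreover `dF` vanishes on `D` at the
points of `π⁻¹(V) ∩ U`. -/
structure IsInvariantExtension (ι : S → P) (D : ∀ s : S, Submodule ℝ (TangentSpace J (ι s)))
    (V : Opens (LeafSpace (tangentPart (E' := E') ι D))) (f : V → ℝ)
    (m : S) (U : Set P) (F : P → ℝ) : Prop extends IsLocalExtension ι D V f m U F where
  kills : ∀ s : S, leafProj (tangentPart (E' := E') ι D) s ∈ V → ι s ∈ U →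
    ∀ v ∈ D s, mvfderiv J F (ι s) v = 0

/-- `f ∈ C^∞_{S/D_S}(V)`. -/
def IsSmoothOnLeafSpace (ι : S → P) (D : ∀ s : S, Submodule ℝ (TangentSpace J (ι s)))
    (V : Opens (LeafSpace (tangentPart (E' := E') ι D))) (f : V → ℝ) : Prop :=
  ∀ z ∈ V, ∃ m : S, leafProj (tangentPart (E' := E') ι D) m = z ∧
    ∃ U F, IsLocalExtension ι D V f m U F

/-- The `(D, D_S)`-local extension property of the presheaf `C^∞_{S/D_S}`. -/
def HasLocalExtensionProperty (ι : S → P)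
    (D : ∀ s : S, Submodule ℝ (TangentSpace J (ι s))) : Prop :=
  ∀ (V : Opens (LeafSpace (tangentPart (E' := E') ι D))) (f : V → ℝ),
    IsSmoothOnLeafSpace ι D V f →
    ∀ z ∈ V, ∃ m : S, leafProj (tangentPart (E' := E') ι D) m = z ∧
      ∃ U F, IsInvariantExtension ι D V f m U F

theorem IsLocalExtension.inter {ι : S → P}
    {D : ∀ s : S, Submodule ℝ (TangentSpace J (ι s))}
    {V : Opens (LeafSpace (tangentPart (E' := E') ι D))} {f g : V → ℝ}
    {m m' : S} {U U' : Set P} {F G : P → ℝ}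
    (hF : IsLocalExtension ι D V f m U F) (hG : IsLocalExtension ι D V g m' U' G)
    (hm : leafProj (tangentPart (E' := E') ι D) m = leafProj (tangentPart (E' := E') ι D) m') :
    IsLocalExtension ι D V f m (U ∩ U') F ∧ IsLocalExtension ι D V g m (U ∩ U') G := by
  have hmem : ι m ∈ U' := (hG.invariant.mem_iff hm).2 hG.mem
  have hinv : IsInvariantSet (tangentPart (E' := E') ι D) (ι ⁻¹' (U ∩ U')) :=
    fun x y h hx => ⟨hF.invariant x y h hx.1, hG.invariant x y h hx.2⟩
  exact ⟨⟨hF.isOpen.inter hG.isOpen, ⟨hF.mem, hmem⟩, hinv, hF.smooth.mono inter_subset_left,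
      fun s hs h => hF.eq s hs h.1⟩,
    ⟨hF.isOpen.inter hG.isOpen, ⟨hF.mem, hmem⟩, hinv, hG.smooth.mono inter_subset_right,
      fun s hs h => hG.eq s hs h.2⟩⟩

/-- The algebra `C^∞_{S/D_S}(V)`. -/
def leafFunctions (ι : S → P)
    (D : ∀ s : S, Submodule ℝ (TangentSpace J (ι s)))
    (V : Opens (LeafSpace (tangentPart (E' := E') ι D))) : Subalgebra ℝ (V → ℝ) where
  carrier := {f | IsSmoothOnLeafSpace ι D V f}
  add_mem' := by
    intro f g hf hg z hz
    obtain ⟨m, hm, U, F, hF⟩ := hf z hz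
    obtain ⟨m', hm', U', G, hG⟩ := hg z hz
    obtain ⟨h1, h2⟩ := hF.inter hG (hm.trans hm'.symm)
    exact ⟨m, hm, U ∩ U', F + G, h1.isOpen, h1.mem, h1.invariant, h1.smooth.add h2.smooth,
      fun s hs h => congrArg₂ (· + ·) (h1.eq s hs h) (h2.eq s hs h)⟩
  mul_mem' := by
    intro f g hf hg z hz
    obtain ⟨m, hm, U, F, hF⟩ := hf z hz
    obtain ⟨m', hm', U', G, hG⟩ := hg z hz
    obtain ⟨h1, h2⟩ := hF.inter hG (hm.trans hm'.symm)
    exact ⟨m, hm, U ∩ U', F * G, h1.isOpen, h1.mem, h1.invariant, h1.smooth.mul h2.smooth,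
      fun s hs h => congrArg₂ (· * ·) (h1.eq s hs h) (h2.eq s hs h)⟩
  algebraMap_mem' := by
    intro r z hz
    obtain ⟨m, rfl⟩ := Quotient.exists_rep z
    exact ⟨m, rfl, univ, fun _ => r, isOpen_univ, mem_univ _, fun _ _ _ _ => mem_univ _,
      contMDiffOn_const, fun s hs h => rfl⟩

/-- The restriction maps of the presheaf `C^∞_{S/D_S}`. -/
def leafRestrict (ι : S → P)
    (D : ∀ s : S, Submodule ℝ (TangentSpace J (ι s)))
    {V V' : Opens (LeafSpace (tangentPart (E' := E') ι D))} (hV : V' ≤ V)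
    (f : leafFunctions (E' := E') ι D V) : leafFunctions (E' := E') ι D V' :=
  ⟨fun z => f.1 ⟨z.1, hV z.2⟩, by
    intro z hz
    obtain ⟨m, hm, U, F, hF⟩ := f.2 z (hV hz)
    exact ⟨m, hm, U, F, hF.isOpen, hF.mem, hF.invariant, hF.smooth,
      fun s hs h => hF.eq s (hV hs) h⟩⟩

/-- `(P, B, D, S)` is Poisson reducible: the prescription `{f, h}_V (π m) = {F, H}_B (m)`, for
all `m ∈ π⁻¹(V)` and all local `D`-invariant extensions `F`, `H` of `f ∘ π`, `h ∘ π` at `m`, gives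
a well-defined structure of presheaf of Poisson algebras on `C^∞_{S/D_S}`. -/
def IsPoissonReducible (B : PoissonTensor J P) (ι : S → P)
    (D : ∀ s : S, Submodule ℝ (TangentSpace J (ι s))) : Prop :=
  ∃ br : ∀ V : Opens (LeafSpace (tangentPart (E' := E') ι D)),
      leafFunctions (E' := E') ι D V →ₗ[ℝ] leafFunctions (E' := E') ι D V →ₗ[ℝ]
        leafFunctions (E' := E') ι D V,
    -- the bracket is given by the bracket of local `D`-invariant extensions
    (∀ V (f h : leafFunctions (E' := E') ι D V) (m : S)
      (hm : leafProj (tangentPart (E' := E') ι D) m ∈ V) (U : Set P) (F H : P → ℝ),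
      IsInvariantExtension ι D V f.1 m U F → IsInvariantExtension ι D V h.1 m U H →
      (br V f h).1 ⟨_, hm⟩ = B.bracket F H (ι m)) ∧
    -- each `C^∞_{S/D_S}(V)` is a Poisson algebra
    (∀ V (f : leafFunctions (E' := E') ι D V), br V f f = 0) ∧
    (∀ V (f g h : leafFunctions (E' := E') ι D V),
      br V f (br V g h) + br V g (br V h f) + br V h (br V f g) = 0) ∧
    (∀ V (f g h : leafFunctions (E' := E') ι D V), br V f (g * h) = br V f g * h + g * br V f h) ∧
    -- the restriction maps preserve the brackets
    (∀ V V' (hV : V' ≤ V) (f h : leafFunctions (E' := E') ι D V),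
      leafRestrict ι D hV (br V f h) = br V' (leafRestrict ι D hV f) (leafRestrict ι D hV h))

/-- `Δ_z`: the differentials at `z` of smooth functions, defined on an open neighbourhood `U` of
`z` in `P`, whose differentials vanish on `D` at the points of `U ∩ S`. -/
def deltaAt (ι : S → P) (D : ∀ s : S, Submodule ℝ (TangentSpace J (ι s))) (z : S) :
    Set (TangentSpace J (ι z) →L[ℝ] ℝ) :=
  {α | ∃ (U : Set P) (f : P → ℝ), IsOpen U ∧ ι z ∈ U ∧ ContMDiffOn J 𝓘(ℝ, ℝ) ∞ f U ∧
    KillsOn ι D f U ∧ mvfderiv J f (ι z) = α}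

/-- `(Δ_z)_S`: the elements of `Δ_z` that come from functions constant on `U ∩ S`. -/
def deltaConstAt (ι : S → P) (D : ∀ s : S, Submodule ℝ (TangentSpace J (ι s))) (z : S) :
    Set (TangentSpace J (ι z) →L[ℝ] ℝ) :=
  {α | ∃ (U : Set P) (f : P → ℝ), IsOpen U ∧ ι z ∈ U ∧ ContMDiffOn J 𝓘(ℝ, ℝ) ∞ f U ∧
    KillsOn ι D f U ∧ (∃ c : ℝ, ∀ s, ι s ∈ U → f (ι s) = c) ∧ mvfderiv J f (ι z) = α}

/-- The annihilator `A° ⊂ T_x P` of a set `A` of covectors at `x`. -/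
def annihilator {x : P} (A : Set (TangentSpace J x →L[ℝ] ℝ)) : Set (TangentSpace J x) :=
  {v | ∀ α ∈ A, α v = 0}

end Reduction

/-! ### Controlled Hamiltonian systems on a cotangent bundle -/

section CH

variable {E : Type*} [NormedAddCommGroup E] [NormedSpace ℝ E]
  {Q : Type*} [TopologicalSpace Q] [ChartedSpace E Q]

/-- The fibre `T*_x Q`. -/
abbrev CotangentFiber (E : Type*) [NormedAddCommGroup E] [NormedSpace ℝ E]
    {Q : Type*} [TopologicalSpace Q] [ChartedSpace E Q] (x : Q) : Type _ :=
  TangentSpace 𝓘(ℝ, E) x →L[ℝ] Bundle.Trivial Q ℝ x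

/-- The cotangent bundle `T*Q`. -/
abbrev Cotangent (E : Type*) [NormedAddCommGroup E] [NormedSpace ℝ E]
    (Q : Type*) [TopologicalSpace Q] [ChartedSpace E Q] [IsManifold 𝓘(ℝ, E) ∞ Q] : Type _ :=
  Bundle.TotalSpace (E →L[ℝ] ℝ) (fun x : Q => CotangentFiber E x)

/-- The model with corners of `T*Q`. -/
abbrev cotModel (E : Type*) [NormedAddCommGroup E] [NormedSpace ℝ E] :
    ModelWithCorners ℝ (E × (E →L[ℝ] ℝ)) (ModelProd E (E →L[ℝ] ℝ)) :=
  𝓘(ℝ, E).prod 𝓘(ℝ, E →L[ℝ] ℝ)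

variable [IsManifold 𝓘(ℝ, E) ∞ Q]

/-- The vertical lift of `η ∈ T*_x Q` at `α ∈ T*_x Q`: the velocity of `s ↦ α + s η` at `s = 0`. -/
def verticalLift (α : Cotangent E Q) (η : CotangentFiber E α.1) :
    TangentSpace (cotModel E) α :=
  mfderiv 𝓘(ℝ, ℝ) (cotModel E)
    (fun s : ℝ => (⟨α.1, α.2 + s • η⟩ : Cotangent E Q)) 0 (1 : ℝ)

/-- A (smooth) splitting of `T T*Q` into the vertical bundle and a horizontal bundle, given by the
map that sends a tangent vector to its vertical part, each vertical space being identified with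
the fibre of `T*Q`. The horizontal bundle is the kernel. -/
structure HorizontalSplitting (E : Type*) [NormedAddCommGroup E] [NormedSpace ℝ E]
    (Q : Type*) [TopologicalSpace Q] [ChartedSpace E Q] [IsManifold 𝓘(ℝ, E) ∞ Q] where
  vert : ∀ α : Cotangent E Q, TangentSpace (cotModel E) α →ₗ[ℝ] CotangentFiber E α.1
  vert_verticalLift : ∀ (α : Cotangent E Q) (η : CotangentFiber E α.1),
    vert α (verticalLift α η) = η
  smooth : ContMDiff (cotModel E).tangent (cotModel E) ∞
    (fun v : TangentBundle (cotModel E) (Cotangent E Q) =>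
      (⟨v.1.1, vert v.1 v.2⟩ : Cotangent E Q))

/-- A smooth fibre-preserving map `T*Q → T*Q`. -/
structure FiberMap (E : Type*) [NormedAddCommGroup E] [NormedSpace ℝ E]
    (Q : Type*) [TopologicalSpace Q] [ChartedSpace E Q] [IsManifold 𝓘(ℝ, E) ∞ Q] where
  onFiber : ∀ x : Q, CotangentFiber E x → CotangentFiber E x
  smooth : ContMDiff (cotModel E) (cotModel E) ∞
    (fun α : Cotangent E Q => (⟨α.1, onFiber α.1 α.2⟩ : Cotangent E Q))

/-- The underlying map of total spaces. -/
def FiberMap.toMap (φ : FiberMap E Q) (α : Cotangent E Q) : Cotangent E Q :=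
  ⟨α.1, φ.onFiber α.1 α.2⟩

/-- `vlift(φ) X (α)`: the vertical part of `Tφ (X α)`, translated from `φ α` to `α` along their
common fibre. -/
def FiberMap.vlift (K : HorizontalSplitting E Q) (φ : FiberMap E Q)
    (X : ∀ α : Cotangent E Q, TangentSpace (cotModel E) α) (α : Cotangent E Q) :
    TangentSpace (cotModel E) α :=
  verticalLift α (K.vert (φ.toMap α) (mfderiv (cotModel E) (cotModel E) φ.toMap α (X α)))

/-- A controlled Hamiltonian system `(T*Q, B, H, F, W)`; the control subset `W` is given by its
inclusion `ι`, and is an embedded submanifold fibred over `Q`. -/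
structure CHSystem (E : Type*) [NormedAddCommGroup E] [NormedSpace ℝ E]
    (Q : Type*) [TopologicalSpace Q] [ChartedSpace E Q] [IsManifold 𝓘(ℝ, E) ∞ Q]
    (E' : Type*) [NormedAddCommGroup E'] [NormedSpace ℝ E']
    (W : Type*) [TopologicalSpace W] [ChartedSpace E' W] [IsManifold 𝓘(ℝ, E') ∞ W] where
  /-- The Poisson tensor `B`. -/
  B : PoissonTensor (cotModel E) (Cotangent E Q)
  /-- The Hamiltonian `H`. -/
  H : Cotangent E Q → ℝ
  smooth_H : ContMDiff (cotModel E) 𝓘(ℝ, ℝ) ∞ H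
  /-- The force map `F`. -/
  F : FiberMap E Q
  /-- The inclusion of the control subset `W`. -/
  ι : W → Cotangent E Q
  submanifold : IsEmbeddedSubmanifold (E' := E') (cotModel E) ι
  surjective : Function.Surjective (fun w => (ι w).1)
  submersion : ∀ w, Function.Surjective (mfderiv 𝓘(ℝ, E') 𝓘(ℝ, E) (fun w => (ι w).1) w)

variable {E' W : Type*} [NormedAddCommGroup E'] [NormedSpace ℝ E']
  [TopologicalSpace W] [ChartedSpace E' W] [IsManifold 𝓘(ℝ, E') ∞ W]

/-- A control law `u : T*Q → W`, a smooth fibre-preserving map with values in `W`. -/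
def CHSystem.ControlLaw (C : CHSystem E Q E' W) : Type _ :=
  {u : FiberMap E Q // ∀ α, u.toMap α ∈ range C.ι}

/-- The Hamiltonian vector field `X_H = B♯ dH`. -/
def CHSystem.hamiltonianField (C : CHSystem E Q E' W) (α : Cotangent E Q) :
    TangentSpace (cotModel E) α :=
  C.B.sharp α (mvfderiv (cotModel E) C.H α)

/-- The dynamical vector field `X_H + vlift(F) X_H + vlift(u) X_H` of the closed-loop system. -/
def CHSystem.dynamicalField (C : CHSystem E Q E' W) (K : HorizontalSplitting E Q)
    (u : C.ControlLaw) (α : Cotangent E Q) : TangentSpace (cotModel E) α :=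
  C.hamiltonianField α + C.F.vlift K C.hamiltonianField α +
    u.1.vlift K C.hamiltonianField α

/-- `W` is a controllability submanifold: any two states are joined by a curve on `[0, 1]` made of
finitely many pieces, each an integral curve of the dynamical vector field of some control law with
values in `W`. (Only a condition when there are control laws at all. If the dynamical vector field
of each single control law joins any two states, then this holds.) -/
def CHSystem.IsControllabilitySubmanifold (C : CHSystem E Q E' W)
    (K : HorizontalSplitting E Q) : Prop :=
  Nonempty C.ControlLaw → ∀ x₀ x₁ : Cotangent E Q,
    ∃ (n : ℕ) (t : ℕ → ℝ) (u : ℕ → C.ControlLaw) (γ : ℝ → Cotangent E Q),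
      t 0 = 0 ∧ t n = 1 ∧ (∀ i < n, t i < t (i + 1)) ∧
      (∀ i < n, IsMIntegralCurveOn (I := cotModel E) γ (C.dynamicalField K (u i))
        (Icc (t i) (t (i + 1)))) ∧
      γ 0 = x₀ ∧ γ 1 = x₁

/-- `D ⊂ T T*Q|_W` is a controllability distribution: it is a Poisson integrable generalized
distribution along the controllability submanifold `W`. -/
structure CHSystem.IsControllabilityDistribution (C : CHSystem E Q E' W)
    (K : HorizontalSplitting E Q)
    (D : ∀ w : W, Submodule ℝ (TangentSpace (cotModel E) (C.ι w))) : Prop where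
  controllable : C.IsControllabilitySubmanifold K
  poisson : IsPoissonDistribution C.B C.ι D
  smooth : IsSmoothDistribution (tangentPart (E' := E') C.ι D)
  integrable : IsIntegrableDistribution (tangentPart (E' := E') C.ι D)

/-- The CH system is Poisson reducible by `D`. -/
def CHSystem.IsPoissonReducibleBy (C : CHSystem E Q E' W)
    (D : ∀ w : W, Submodule ℝ (TangentSpace (cotModel E) (C.ι w))) : Prop :=
  IsPoissonReducible (E' := E') C.B C.ι D

end CH

end

end PoissonReduction

open PoissonReduction

namespace PoissonReduction

/-! ### The Poisson bracket of functions -/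

section Bracket

variable {EP HP P : Type*} [NormedAddCommGroup EP] [NormedSpace ℝ EP]
  [TopologicalSpace HP] {J : ModelWithCorners ℝ EP HP}
  [TopologicalSpace P] [ChartedSpace HP P]

/-! The argument takes place on a Poisson manifold `P` with a submanifold `ι : S → P` and a Poisson
distribution `D` along `S`; the theorem is the case of the cotangent bundle and the control
submanifold.

Sufficiency. Two invariant extensions of one function differ, over `V`, by a function that vanishes
on `S` and is killed by `D`. Its differential lies in `deltaConstAt`, so the inclusion says exactly
that the difference has zero bracket with every invariant extension: the bracket does not depend on
the extensions (`bracket_eq_of_isInvariantExtension`). As `D` is Poisson, the bracket is again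
killed by `D`, hence constant on leaves (`KillsOn.eq_of_leafProj_eq`). It is therefore an invariant
extension of the function it induces (`IsInvariantExtension.bracket`), and all Poisson identities
are inherited from `P`.

Necessity. Let `f` and `g` be killed by `D` near `z`, with `g` constant on `S`; the claim is `{g,
f}(z) = 0`. The domain of `f` need not have invariant trace on `S`, so `f` need not descend to the
leaf space, and two cases are separated. If `D z` is nonzero, the Poisson property of `D` suffices:
after subtracting its constant, `g` may be multiplied by an arbitrary smooth `a` and stays killed by
`D`, and the invariance of `{a g, f}` for an `a` that varies along `D z` forces the claim. If `D z =
0`, regularity makes the leaves near `z` single points, so `f` does descend, `g` extends a constant,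
and the reduced bracket with a constant vanishes by the Leibniz rule. -/

theorem mdifferentiableAt_of_contMDiffOn {f : P → ℝ} {U : Set P} {x : P}
    (hf : ContMDiffOn J 𝓘(ℝ, ℝ) ∞ f U) (hU : IsOpen U) (hx : x ∈ U) :
    MDifferentiableAt J 𝓘(ℝ, ℝ) f x :=
  (hf.contMDiffAt (hU.mem_nhds hx)).mdifferentiableAt (by simp)

theorem mvfderiv_congr_of_eqOn {f g : P → ℝ} {U : Set P} {x : P} (h : EqOn f g U)
    (hU : IsOpen U) (hx : x ∈ U) : mvfderiv J f x = mvfderiv J g x := by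
  have hfg : f =ᶠ[𝓝 x] g := h.eventuallyEq_of_mem (hU.mem_nhds hx)
  exact hfg.mfderiv_eq (I := J) (I' := 𝓘(ℝ, ℝ))

theorem mvfderiv_const_mul {f : P → ℝ} {x : P} (c : ℝ) (hf : MDifferentiableAt J 𝓘(ℝ, ℝ) f x) :
    mvfderiv J (fun y => c * f y) x = c • mvfderiv J f x := by
  have h := mvfderiv_fun_mul (I := J) (f := fun _ : P => c) mdifferentiableAt_const hf
  rw [h, mvfderiv_const, smul_zero, add_zero]

namespace PoissonTensor

variable (B : PoissonTensor J P)

theorem bracket_antisymm (f g : P → ℝ) (x : P) : B.bracket f g x = -B.bracket g f x :=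
  B.antisymm x _ _

theorem bracket_add_left {f g : P → ℝ} (h : P → ℝ) {x : P}
    (hf : MDifferentiableAt J 𝓘(ℝ, ℝ) f x) (hg : MDifferentiableAt J 𝓘(ℝ, ℝ) g x) :
    B.bracket (f + g) h x = B.bracket f h x + B.bracket g h x := by
  simp only [bracket]
  rw [mvfderiv_add hf hg]
  rfl

theorem bracket_sub_left {f g : P → ℝ} (h : P → ℝ) {x : P}
    (hf : MDifferentiableAt J 𝓘(ℝ, ℝ) f x) (hg : MDifferentiableAt J 𝓘(ℝ, ℝ) g x) :
    B.bracket (f - g) h x = B.bracket f h x - B.bracket g h x := by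
  simp only [bracket]
  rw [mvfderiv_sub hf hg]
  rfl

theorem bracket_const_mul_left (c : ℝ) {f : P → ℝ} (h : P → ℝ) {x : P}
    (hf : MDifferentiableAt J 𝓘(ℝ, ℝ) f x) :
    B.bracket (fun y => c * f y) h x = c * B.bracket f h x := by
  simp only [bracket]
  rw [mvfderiv_const_mul c hf]
  rfl

theorem bracket_mul_left {f g : P → ℝ} (h : P → ℝ) {x : P}
    (hf : MDifferentiableAt J 𝓘(ℝ, ℝ) f x) (hg : MDifferentiableAt J 𝓘(ℝ, ℝ) g x) :
    B.bracket (f * g) h x = f x * B.bracket g h x + g x * B.bracket f h x := by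
  simp only [bracket]
  rw [mvfderiv_mul hf hg]
  rfl

theorem contMDiffOn_bracket {U : Set P} (hU : IsOpen U) {f g : P → ℝ}
    (hf : ContMDiffOn J 𝓘(ℝ, ℝ) ∞ f U) (hg : ContMDiffOn J 𝓘(ℝ, ℝ) ∞ g U) :
    ContMDiffOn J 𝓘(ℝ, ℝ) ∞ (B.bracket f g) U :=
  B.smooth U hU f g hf hg

end PoissonTensor

/-- On a manifold, a nonzero tangent vector is detected by the differential of a smooth function. -/
theorem exists_contMDiffOn_mvfderiv_ne_zero [IsManifold J ∞ P] (x : P)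
    {v : TangentSpace J x} (hv : v ≠ 0) :
    ∃ (O : Set P) (a : P → ℝ), IsOpen O ∧ x ∈ O ∧ ContMDiffOn J 𝓘(ℝ, ℝ) ∞ a O ∧
      mvfderiv J a x v ≠ 0 := by
  have : IsManifold J 1 P := IsManifold.of_le (n := ∞) (by simp)
  have hinv := isInvertible_mfderiv_extChartAt (I := J) (mem_extChartAt_source (I := J) x)
  set w : EP := mfderiv J 𝓘(ℝ, EP) (extChartAt J x) x v with hw
  have hw0 : w ≠ 0 := fun h => hv (hinv.injective (by rw [map_zero]; exact h))
  -- Hahn–Banach: `ℓ w = ‖w‖`, and `ℓ` read in the chart is the required function.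
  obtain ⟨ℓ, -, hℓ⟩ := exists_dual_vector ℝ w (norm_ne_zero_iff.2 hw0)
  refine ⟨(chartAt HP x).source, fun y => ℓ (extChartAt J x y), (chartAt HP x).open_source,
    mem_chart_source HP x, ℓ.contMDiff.comp_contMDiffOn contMDiffOn_extChartAt, ?_⟩
  have hcomp := mvfderiv_comp_apply (I := 𝓘(ℝ, EP)) (I' := J) (g := ℓ) (f := extChartAt J x) x
    ℓ.mdifferentiableAt (mdifferentiableAt_extChartAt (mem_chart_source HP x)) v
  have hℓ' : mvfderiv 𝓘(ℝ, EP) ℓ (extChartAt J x x) = ℓ := ℓ.mfderiv_eq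
  rw [hℓ'] at hcomp
  intro h
  have h0 : ℓ w = 0 := hcomp.symm.trans h
  rw [h0] at hℓ
  exact hw0 (norm_eq_zero.1 (by exact_mod_cast hℓ.symm))

end Bracket

/-! ### Leaves -/

section Leaves

variable {E' S : Type*} [NormedAddCommGroup E'] [NormedSpace ℝ E']
  [TopologicalSpace S] [ChartedSpace E' S]

/-- The derivative of `K ∘ γ` is `dK (X)`, which vanishes. The conditions on `K` are imposed only
along `γ`, so that locally defined functions are covered. -/
theorem apply_eq_of_isMIntegralCurveOn {γ : ℝ → S} {X : ∀ y : S, TangentSpace 𝓘(ℝ, E') y}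
    {a b : ℝ} (hab : a ≤ b) (hγ : IsMIntegralCurveOn (I := 𝓘(ℝ, E')) γ X (Icc a b)) {K : S → ℝ}
    (hK : ∀ t ∈ Icc a b, MDifferentiableAt 𝓘(ℝ, E') 𝓘(ℝ, ℝ) K (γ t))
    (h0 : ∀ t ∈ Icc a b, mvfderiv 𝓘(ℝ, E') K (γ t) (X (γ t)) = 0) : K (γ b) = K (γ a) := by
  have hd : ∀ t ∈ Icc a b, HasDerivWithinAt (K ∘ γ) 0 (Icc a b) t := by
    intro t ht
    have h1 := (hK t ht).hasMFDerivAt.comp_hasMFDerivWithinAt t (hγ t ht)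
    have h2 : (mfderiv 𝓘(ℝ, E') 𝓘(ℝ, ℝ) K (γ t)).comp
        ((1 : ℝ →L[ℝ] ℝ).smulRight (X (γ t))) = (0 : ℝ →L[ℝ] ℝ) := by
      ext
      change mvfderiv 𝓘(ℝ, E') K (γ t) ((1 : ℝ) • X (γ t)) = 0
      rw [one_smul, h0 t ht]
    have h3 : HasFDerivWithinAt (K ∘ γ) (0 : ℝ →L[ℝ] ℝ) (Icc a b) t :=
      (h1.congr_mfderiv h2).hasFDerivWithinAt
    simpa using h3.hasDerivWithinAt
  refine constant_of_derivWithin_zero (f := K ∘ γ) (fun t ht => (hd t ht).differentiableWithinAt)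
    (fun t ht => ?_) b ⟨hab, le_rfl⟩
  -- A point of `Ico a b` forces `a < b`, without which the derivative within `Icc a b` would not be
  -- unique.
  exact (hd t (Ico_subset_Icc_self ht)).derivWithin
    (uniqueDiffOn_Icc (ht.1.trans_lt ht.2) t (Ico_subset_Icc_self ht))

variable {Δ : ∀ y : S, Submodule ℝ (TangentSpace 𝓘(ℝ, E') y)}

/-- The points at which a regular distribution vanishes form an open and closed set. -/
theorem IsRegularDistribution.isClopen_setOf_eq_bot [FiniteDimensional ℝ E']
    (hΔ : IsRegularDistribution Δ) : IsClopen {y : S | Δ y = ⊥} := by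
  -- Finite dimension is essential here: `finrank` is also 0, by default, on spaces of infinite
  -- rank.
  have hfin : ∀ y : S, Δ y = ⊥ ↔ Module.finrank ℝ (Δ y) = 0 := fun y => by
    have : FiniteDimensional ℝ (TangentSpace 𝓘(ℝ, E') y) := inferInstanceAs (FiniteDimensional ℝ E')
    exact Submodule.finrank_eq_zero.symm
  simp only [hfin]
  constructor
  · rw [← isOpen_compl_iff, isOpen_iff_mem_nhds]
    intro y hy
    filter_upwards [hΔ y] with y' hy'
    simpa [hy'] using hy
  · rw [isOpen_iff_mem_nhds]
    intro y hy
    filter_upwards [hΔ y] with y' hy'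
    simpa [hy'] using hy

variable [IsManifold 𝓘(ℝ, E') ∞ S]

/-- The intermediate points of an integral curve of a local section are reached by its flow. -/
theorem flowStep_of_isMIntegralCurveOn {O : Set S} {X : ∀ y : S, TangentSpace 𝓘(ℝ, E') y}
    {γ : ℝ → S} {a b : ℝ} (hX : IsLocalSection Δ O X)
    (hγ : IsMIntegralCurveOn (I := 𝓘(ℝ, E')) γ X (Icc a b)) (hO : MapsTo γ (Icc a b) O)
    {t : ℝ} (ht : t ∈ Icc a b) : FlowStep Δ (γ a) (γ t) :=
  ⟨O, X, γ, a, t, hX, ht.1, hγ.mono (Icc_subset_Icc_right ht.2),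
    hO.mono_left (Icc_subset_Icc_right ht.2), rfl, rfl⟩

theorem isInvariantSet_preimage_leafProj (A : Set (LeafSpace Δ)) :
    IsInvariantSet Δ (leafProj Δ ⁻¹' A) := by
  intro x y h hx
  have : leafProj Δ x = leafProj Δ y := Quotient.sound (Relation.EqvGen.rel _ _ h)
  exact (congrArg (· ∈ A) this).mp hx

theorem IsInvariantSet.inter {A A' : Set S} (hA : IsInvariantSet Δ A) (hA' : IsInvariantSet Δ A') :
    IsInvariantSet Δ (A ∩ A') :=
  fun x y h hx => ⟨hA x y h hx.1, hA' x y h hx.2⟩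

theorem continuous_leafProj : Continuous (leafProj Δ) := continuous_quotient_mk'

/-- Where a regular distribution vanishes, its leaves are points. -/
theorem IsRegularDistribution.isInvariantSet_singleton [FiniteDimensional ℝ E'] [T2Space S]
    [SecondCountableTopology S] (hΔ : IsRegularDistribution Δ) {x : S} (hx : Δ x = ⊥) :
    IsInvariantSet Δ {x} := by
  rintro x' y ⟨O, X, γ, a, b, hX, hab, hγ, hO, rfl, rfl⟩ hmem
  obtain rfl : γ a = x := hmem
  have hcont : ContinuousOn γ (Icc a b) := fun t ht => (hγ t ht).continuousWithinAt
  have hzero : ∀ t ∈ Icc a b, X (γ t) = 0 := by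
    intro t ht
    -- A connected curve that starts in the clopen zero locus stays in it, so its velocity is zero
    -- throughout.
    have hsub : γ '' Icc a b ⊆ {y : S | Δ y = ⊥} :=
      (isPreconnected_Icc.image γ hcont).subset_isClopen hΔ.isClopen_setOf_eq_bot
        ⟨γ a, mem_image_of_mem γ ⟨le_rfl, hab⟩, hx⟩
    have hbot : Δ (γ t) = ⊥ := hsub (mem_image_of_mem γ ht)
    simpa [hbot] using hX.mem (γ t) (hO ht)
  by_contra hne
  -- Distinct endpoints would be separated by a smooth function, which is nevertheless constant
  -- along a curve of zero velocity.
  have : LocallyCompactSpace S := Manifold.locallyCompact_of_finiteDimensional 𝓘(ℝ, E')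
  obtain ⟨f, hf0, hf1, -⟩ := exists_contMDiffMap_zero_one_of_isClosed (n := 1) 𝓘(ℝ, E')
    (isClosed_singleton (x := γ a)) (isClosed_singleton (x := γ b))
    (disjoint_singleton.2 fun h => hne h.symm)
  have h := apply_eq_of_isMIntegralCurveOn hab hγ (K := f)
    (fun t _ => f.contMDiff.contMDiffAt.mdifferentiableAt (by simp))
    (fun t ht => by rw [hzero t ht, map_zero])
  rw [hf0 rfl, hf1 rfl] at h
  exact one_ne_zero h

end Leaves

/-! ### Invariant extensions -/

section Extensions

variable {EP HP P : Type*} [NormedAddCommGroup EP] [NormedSpace ℝ EP]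
  [TopologicalSpace HP] {J : ModelWithCorners ℝ EP HP}
  [TopologicalSpace P] [ChartedSpace HP P]
  {S : Type*} {ι : S → P} {D : ∀ s : S, Submodule ℝ (TangentSpace J (ι s))}

theorem KillsOn.mono {f : P → ℝ} {U U' : Set P} (h : KillsOn ι D f U) (hU : U' ⊆ U) :
    KillsOn ι D f U' :=
  fun s hs => h s (hU hs)

variable {E' : Type*} [NormedAddCommGroup E'] [NormedSpace ℝ E']
  [TopologicalSpace S] [ChartedSpace E' S] [IsManifold 𝓘(ℝ, E') ∞ S]

/-- A function whose differential vanishes on `D` is constant on the leaves of `D_S`. -/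
theorem KillsOn.eq_of_leafProj_eq (hι : IsEmbeddedSubmanifold (E' := E') J ι) {U : Set P}
    {f : P → ℝ} (hU : IsOpen U)
    (hinv : IsInvariantSet (tangentPart (E' := E') ι D) (ι ⁻¹' U))
    (hf : ContMDiffOn J 𝓘(ℝ, ℝ) ∞ f U) (hk : KillsOn ι D f U) {m m' : S} (hm : ι m ∈ U)
    (h : leafProj (tangentPart (E' := E') ι D) m = leafProj (tangentPart (E' := E') ι D) m') :
    f (ι m) = f (ι m') := by
  -- This level set is a union of leaves once it is flow invariant. Membership in `U` is part of it
  -- because `f` is controlled only there; invariance of the trace of `U` keeps whole integral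
  -- curves inside.
  have hA : IsInvariantSet (tangentPart (E' := E') ι D) {s | ι s ∈ U ∧ f (ι m) = f (ι s)} := by
    rintro x y ⟨O, X, γ, a, b, hX, hab, hγ, hO, rfl, rfl⟩ ⟨hxU, hx⟩
    have hγU : ∀ t ∈ Icc a b, ι (γ t) ∈ U := fun t ht =>
      hinv _ _ (flowStep_of_isMIntegralCurveOn hX hγ hO ht) hxU
    have hιd : ∀ s, MDifferentiableAt 𝓘(ℝ, E') J ι s := fun s =>
      hι.smooth.contMDiffAt.mdifferentiableAt (by simp)
    have hfd : ∀ t ∈ Icc a b, MDifferentiableAt J 𝓘(ℝ, ℝ) f (ι (γ t)) := fun t ht =>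
      mdifferentiableAt_of_contMDiffOn hf hU (hγU t ht)
    refine ⟨hγU b ⟨hab, le_rfl⟩, hx.trans ?_⟩
    refine (apply_eq_of_isMIntegralCurveOn (K := f ∘ ι) hab hγ
      (fun t ht => (hfd t ht).comp (γ t) (hιd (γ t))) fun t ht => ?_).symm
    rw [mvfderiv_comp_apply (γ t) (hfd t ht) (hιd (γ t))]
    exact hk (γ t) (hγU t ht) _ (hX.mem (γ t) (hO ht))
  exact ((hA.mem_iff h).1 ⟨hm, rfl⟩).2

/-- A neighbourhood with invariant trace on `S` can be shrunk so that its trace is contained in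
the preimage of an open subset of the leaf space. -/
theorem exists_isOpen_preimage_eq_inter (hι : IsEmbedding ι)
    (V : Opens (LeafSpace (tangentPart (E' := E') ι D))) {U : Set P} (hU : IsOpen U)
    (hinv : IsInvariantSet (tangentPart (E' := E') ι D) (ι ⁻¹' U)) :
    ∃ U' ⊆ U, IsOpen U' ∧ IsInvariantSet (tangentPart (E' := E') ι D) (ι ⁻¹' U') ∧
      ∀ s, ι s ∈ U' ↔ ι s ∈ U ∧ leafProj (tangentPart (E' := E') ι D) s ∈ V := by
  -- In the relative topology, the preimage of `V` is the trace of an open subset of `P`.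
  obtain ⟨O, hO, hOV⟩ := hι.isInducing.isOpen_iff.1
    (V.isOpen.preimage (continuous_leafProj (Δ := tangentPart (E' := E') ι D)))
  have hmem : ∀ s, ι s ∈ O ↔ leafProj (tangentPart (E' := E') ι D) s ∈ V := fun s =>
    Set.ext_iff.1 hOV s
  refine ⟨U ∩ O, inter_subset_left, hU.inter hO, ?_, fun s => and_congr_right fun _ => hmem s⟩
  rw [preimage_inter, hOV]
  exact hinv.inter (isInvariantSet_preimage_leafProj _)

variable {V : Opens (LeafSpace (tangentPart (E' := E') ι D))} {f g : V → ℝ} {m m' : S}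
  {U U' : Set P} {F G : P → ℝ}

namespace IsInvariantExtension

/-- An invariant extension at a point is one at all points of its domain. -/
theorem at_point (hF : IsInvariantExtension ι D V f m U F) (h : ι m' ∈ U) :
    IsInvariantExtension ι D V f m' U F :=
  ⟨⟨hF.isOpen, h, hF.invariant, hF.smooth, hF.eq⟩, hF.kills⟩

theorem at_leaf (hF : IsInvariantExtension ι D V f m U F)
    (h : leafProj (tangentPart (E' := E') ι D) m = leafProj (tangentPart (E' := E') ι D) m') :
    IsInvariantExtension ι D V f m' U F :=
  hF.at_point ((hF.invariant.mem_iff h).1 hF.mem)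

theorem inter (hF : IsInvariantExtension ι D V f m U F)
    (hG : IsInvariantExtension ι D V g m U' G) :
    IsInvariantExtension ι D V f m (U ∩ U') F ∧ IsInvariantExtension ι D V g m (U ∩ U') G :=
  have h := hF.toIsLocalExtension.inter hG.toIsLocalExtension rfl
  ⟨⟨h.1, fun s hs hU => hF.kills s hs hU.1⟩, ⟨h.2, fun s hs hU => hG.kills s hs hU.2⟩⟩

theorem mono {V' : Opens (LeafSpace (tangentPart (E' := E') ι D))} (hV : V' ≤ V)
    (hF : IsInvariantExtension ι D V f m U F) :
    IsInvariantExtension ι D V' (fun z => f ⟨z.1, hV z.2⟩) m U F :=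
  ⟨⟨hF.isOpen, hF.mem, hF.invariant, hF.smooth, fun s hs h => hF.eq s (hV hs) h⟩,
    fun s hs => hF.kills s (hV hs)⟩

theorem mdifferentiableAt (hF : IsInvariantExtension ι D V f m U F) {x : P} (hx : x ∈ U) :
    MDifferentiableAt J 𝓘(ℝ, ℝ) F x :=
  mdifferentiableAt_of_contMDiffOn hF.smooth hF.isOpen hx

theorem add (hF : IsInvariantExtension ι D V f m U F)
    (hG : IsInvariantExtension ι D V g m U G) :
    IsInvariantExtension ι D V (f + g) m U (F + G) where
  isOpen := hF.isOpen
  mem := hF.mem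
  invariant := hF.invariant
  smooth := hF.smooth.add hG.smooth
  eq s hs h := congrArg₂ (· + ·) (hF.eq s hs h) (hG.eq s hs h)
  kills s hs h v hv := by
    rw [mvfderiv_add (hF.mdifferentiableAt h) (hG.mdifferentiableAt h)]
    simp [hF.kills s hs h v hv, hG.kills s hs h v hv]

theorem mul (hF : IsInvariantExtension ι D V f m U F)
    (hG : IsInvariantExtension ι D V g m U G) :
    IsInvariantExtension ι D V (f * g) m U (F * G) where
  isOpen := hF.isOpen
  mem := hF.mem
  invariant := hF.invariant
  smooth := hF.smooth.mul hG.smooth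
  eq s hs h := congrArg₂ (· * ·) (hF.eq s hs h) (hG.eq s hs h)
  kills s hs h v hv := by
    rw [mvfderiv_mul (hF.mdifferentiableAt h) (hG.mdifferentiableAt h)]
    simp [hF.kills s hs h v hv, hG.kills s hs h v hv]

theorem const_smul (c : ℝ) (hF : IsInvariantExtension ι D V f m U F) :
    IsInvariantExtension ι D V (c • f) m U (fun x => c * F x) where
  isOpen := hF.isOpen
  mem := hF.mem
  invariant := hF.invariant
  smooth := contMDiffOn_const.mul hF.smooth
  eq s hs h := congrArg (c * ·) (hF.eq s hs h)
  kills s hs h v hv := by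
    rw [mvfderiv_const_mul c (hF.mdifferentiableAt h)]
    simp [hF.kills s hs h v hv]

end IsInvariantExtension

/-- The property supplies an extension at one unspecified point of each leaf; its domain has
invariant trace, so it contains the whole leaf. -/
theorem HasLocalExtensionProperty.exists_at (hext : HasLocalExtensionProperty (E' := E') ι D)
    (hf : f ∈ leafFunctions (E' := E') ι D V)
    (hm : leafProj (tangentPart (E' := E') ι D) m ∈ V) :
    ∃ U F, IsInvariantExtension ι D V f m U F := by
  obtain ⟨m', hm', U, F, hF⟩ := hext V f hf _ hm
  exact ⟨U, F, hF.at_leaf hm'⟩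

theorem HasLocalExtensionProperty.exists_at₂ (hext : HasLocalExtensionProperty (E' := E') ι D)
    (hf : f ∈ leafFunctions (E' := E') ι D V) (hg : g ∈ leafFunctions (E' := E') ι D V)
    (hm : leafProj (tangentPart (E' := E') ι D) m ∈ V) :
    ∃ U F G, IsInvariantExtension ι D V f m U F ∧ IsInvariantExtension ι D V g m U G := by
  obtain ⟨U, F, hF⟩ := hext.exists_at hf hm
  obtain ⟨U', G, hG⟩ := hext.exists_at hg hm
  exact ⟨U ∩ U', F, G, hF.inter hG⟩

theorem HasLocalExtensionProperty.exists_at₃ (hext : HasLocalExtensionProperty (E' := E') ι D)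
    {h : V → ℝ} (hf : f ∈ leafFunctions (E' := E') ι D V)
    (hg : g ∈ leafFunctions (E' := E') ι D V) (hh : h ∈ leafFunctions (E' := E') ι D V)
    (hm : leafProj (tangentPart (E' := E') ι D) m ∈ V) :
    ∃ U F G H, IsInvariantExtension ι D V f m U F ∧ IsInvariantExtension ι D V g m U G ∧
      IsInvariantExtension ι D V h m U H := by
  obtain ⟨U, F, G, hF, hG⟩ := hext.exists_at₂ hf hg hm
  obtain ⟨U', H, hH⟩ := hext.exists_at hh hm
  exact ⟨U ∩ U', F, G, H, (hF.inter hH).1, hG.inter hH⟩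

end Extensions

/-! ### The reduced bracket -/

section ReducedBracket

variable {EP HP P : Type*} [NormedAddCommGroup EP] [NormedSpace ℝ EP]
  [TopologicalSpace HP] {J : ModelWithCorners ℝ EP HP}
  [TopologicalSpace P] [ChartedSpace HP P]
  {E' S : Type*} [NormedAddCommGroup E'] [NormedSpace ℝ E']
  [TopologicalSpace S] [ChartedSpace E' S] [IsManifold 𝓘(ℝ, E') ∞ S]
  {ι : S → P} {D : ∀ s : S, Submodule ℝ (TangentSpace J (ι s))} {B : PoissonTensor J P}
  {V : Opens (LeafSpace (tangentPart (E' := E') ι D))} {f g : V → ℝ} {m : S}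
  {U U' : Set P} {F F' G G' : P → ℝ}

/-- Two invariant extensions of the same function have the same bracket with any third one. -/
theorem bracket_eq_of_isInvariantExtension_left (hι : IsEmbedding ι)
    (hB : B.sharp (ι m) '' deltaAt ι D m ⊆ annihilator (deltaConstAt ι D m))
    (hm : leafProj (tangentPart (E' := E') ι D) m ∈ V)
    (hF : IsInvariantExtension ι D V f m U F) (hF' : IsInvariantExtension ι D V f m U F')
    (hG : IsInvariantExtension ι D V g m U G) :
    B.bracket F G (ι m) = B.bracket F' G (ι m) := by
  -- Extensions are controlled only over `V`, whereas `deltaAt` and `deltaConstAt` ask for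
  -- conditions on a full trace; hence the smaller `O`.
  obtain ⟨O, hOU, hO, -, hOV⟩ := exists_isOpen_preimage_eq_inter hι V hF.isOpen hF.invariant
  have hmO : ι m ∈ O := (hOV m).2 ⟨hF.mem, hm⟩
  have hFF' : mvfderiv J (F - F') (ι m) ∈ deltaConstAt ι D m := by
    refine ⟨O, F - F', hO, hmO, (hF.smooth.sub hF'.smooth).mono hOU, ?_, ⟨0, ?_⟩, rfl⟩
    · intro s hs v hv
      obtain ⟨hsU, hsV⟩ := (hOV s).1 hs
      rw [mvfderiv_sub (hF.mdifferentiableAt hsU) (hF'.mdifferentiableAt hsU)]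
      simp [hF.kills s hsV hsU v hv, hF'.kills s hsV hsU v hv]
    · intro s hs
      obtain ⟨hsU, hsV⟩ := (hOV s).1 hs
      exact sub_eq_zero.2 ((hF.eq s hsV hsU).symm.trans (hF'.eq s hsV hsU))
  have hG' : mvfderiv J G (ι m) ∈ deltaAt ι D m :=
    ⟨O, G, hO, hmO, hG.smooth.mono hOU,
      fun s hs => hG.kills s ((hOV s).1 hs).2 ((hOV s).1 hs).1, rfl⟩
  have h0 : B.bracket (F - F') G (ι m) = 0 := hB (mem_image_of_mem _ hG') _ hFF'
  rw [B.bracket_sub_left G (hF.mdifferentiableAt hF.mem) (hF'.mdifferentiableAt hF.mem)] at h0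
  exact sub_eq_zero.1 h0

/-- The bracket of invariant extensions does not depend on their choice. -/
theorem bracket_eq_of_isInvariantExtension (hι : IsEmbedding ι)
    (hB : B.sharp (ι m) '' deltaAt ι D m ⊆ annihilator (deltaConstAt ι D m))
    (hm : leafProj (tangentPart (E' := E') ι D) m ∈ V)
    (hF : IsInvariantExtension ι D V f m U F) (hF' : IsInvariantExtension ι D V f m U' F')
    (hG : IsInvariantExtension ι D V g m U G) (hG' : IsInvariantExtension ι D V g m U' G') :
    B.bracket F G (ι m) = B.bracket F' G' (ι m) := by
  obtain ⟨hF₁, hF₁'⟩ := hF.inter hF'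
  obtain ⟨hG₁, hG₁'⟩ := hG.inter hG'
  -- Replace `F` with `G` fixed, then `G` with `F'` fixed, by antisymmetry.
  rw [bracket_eq_of_isInvariantExtension_left hι hB hm hF₁ hF₁' hG₁, B.bracket_antisymm,
    bracket_eq_of_isInvariantExtension_left hι hB hm hG₁ hG₁' hF₁', ← B.bracket_antisymm]

/-- If `D` is Poisson, the bracket of invariant extensions is annihilated by `D`. -/
theorem killsOn_bracket_of_isInvariantExtension (hι : IsEmbedding ι)
    (hD : IsPoissonDistribution B ι D) (hF : IsInvariantExtension ι D V f m U F)
    (hG : IsInvariantExtension ι D V g m U G) :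
    ∃ O ⊆ U, IsOpen O ∧ IsInvariantSet (tangentPart (E' := E') ι D) (ι ⁻¹' O) ∧
      (∀ s, ι s ∈ O ↔ ι s ∈ U ∧ leafProj (tangentPart (E' := E') ι D) s ∈ V) ∧
      KillsOn ι D (B.bracket F G) O := by
  obtain ⟨O, hOU, hO, hOinv, hOV⟩ := exists_isOpen_preimage_eq_inter hι V hF.isOpen hF.invariant
  exact ⟨O, hOU, hO, hOinv, hOV, hD O hO F G (hF.smooth.mono hOU) (hG.smooth.mono hOU)
    (fun s hs => hF.kills s ((hOV s).1 hs).2 ((hOV s).1 hs).1)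
    (fun s hs => hG.kills s ((hOV s).1 hs).2 ((hOV s).1 hs).1)⟩

/-- The bracket of invariant extensions is constant on leaves. -/
theorem bracket_eq_of_leafProj_eq (hι : IsEmbeddedSubmanifold (E' := E') J ι)
    (hD : IsPoissonDistribution B ι D) (hF : IsInvariantExtension ι D V f m U F)
    (hG : IsInvariantExtension ι D V g m U G) {m' : S}
    (hm : leafProj (tangentPart (E' := E') ι D) m ∈ V)
    (h : leafProj (tangentPart (E' := E') ι D) m = leafProj (tangentPart (E' := E') ι D) m') :
    B.bracket F G (ι m) = B.bracket F G (ι m') := by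
  obtain ⟨O, hOU, hO, hOinv, hOV, hk⟩ :=
    killsOn_bracket_of_isInvariantExtension hι.isEmbedding hD hF hG
  exact hk.eq_of_leafProj_eq hι hO hOinv
    ((B.contMDiffOn_bracket hF.isOpen hF.smooth hG.smooth).mono hOU)
    ((hOV m).2 ⟨hF.mem, hm⟩) h

open Classical in
/-- The function `{f, g}_V` on the open subset `V` of the leaf space, computed with chosen
invariant extensions. -/
noncomputable def reducedBracket (B : PoissonTensor J P) (ι : S → P)
    (D : ∀ s : S, Submodule ℝ (TangentSpace J (ι s)))
    (V : Opens (LeafSpace (tangentPart (E' := E') ι D))) (f g : V → ℝ) (z : V) : ℝ :=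
  -- The default 0 is never reached for members of `leafFunctions` under the local extension
  -- property.
  if h : ∃ (U : Set P) (F G : P → ℝ), IsInvariantExtension ι D V f z.1.out U F ∧
      IsInvariantExtension ι D V g z.1.out U G
  then B.bracket h.choose_spec.choose h.choose_spec.choose_spec.choose (ι z.1.out) else 0

/-- The definition makes two choices: a point on the leaf, harmless since brackets are constant on
leaves, and a pair of extensions, harmless by the inclusion `hB`. -/
theorem reducedBracket_apply (hι : IsEmbeddedSubmanifold (E' := E') J ι)
    (hD : IsPoissonDistribution B ι D)
    (hB : ∀ z, B.sharp (ι z) '' deltaAt ι D z ⊆ annihilator (deltaConstAt ι D z))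
    (hF : IsInvariantExtension ι D V f m U F) (hG : IsInvariantExtension ι D V g m U G)
    (hm : leafProj (tangentPart (E' := E') ι D) m ∈ V) :
    reducedBracket B ι D V f g ⟨_, hm⟩ = B.bracket F G (ι m) := by
  set n : S := (leafProj (tangentPart (E' := E') ι D) m).out with hn
  have hnm : leafProj (tangentPart (E' := E') ι D) m = leafProj (tangentPart (E' := E') ι D) n :=
    (Quotient.out_eq _).symm
  have h : ∃ (U : Set P) (F G : P → ℝ), IsInvariantExtension ι D V f n U F ∧
      IsInvariantExtension ι D V g n U G := ⟨U, F, G, hF.at_leaf hnm, hG.at_leaf hnm⟩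
  rw [bracket_eq_of_leafProj_eq hι hD hF hG hm hnm]
  have hs := h.choose_spec.choose_spec.choose_spec
  exact (dif_pos h).trans (bracket_eq_of_isInvariantExtension hι.isEmbedding (hB n) (hnm ▸ hm)
    hs.1 (hF.at_leaf hnm) hs.2 (hG.at_leaf hnm))

/-- The bracket of invariant extensions is an invariant extension of the reduced bracket. -/
theorem IsInvariantExtension.bracket (hι : IsEmbeddedSubmanifold (E' := E') J ι)
    (hD : IsPoissonDistribution B ι D)
    (hB : ∀ z, B.sharp (ι z) '' deltaAt ι D z ⊆ annihilator (deltaConstAt ι D z))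
    (hF : IsInvariantExtension ι D V f m U F) (hG : IsInvariantExtension ι D V g m U G) :
    IsInvariantExtension ι D V (reducedBracket B ι D V f g) m U (B.bracket F G) where
  isOpen := hF.isOpen
  mem := hF.mem
  invariant := hF.invariant
  smooth := B.contMDiffOn_bracket hF.isOpen hF.smooth hG.smooth
  eq s hs h := reducedBracket_apply hι hD hB (hF.at_point h) (hG.at_point h) hs
  kills s hs h := by
    obtain ⟨O, -, -, -, hOV, hk⟩ :=
      killsOn_bracket_of_isInvariantExtension hι.isEmbedding hD hF hG
    exact hk s ((hOV s).2 ⟨h, hs⟩)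

theorem reducedBracket_mem (hι : IsEmbeddedSubmanifold (E' := E') J ι)
    (hD : IsPoissonDistribution B ι D) (hext : HasLocalExtensionProperty (E' := E') ι D)
    (hB : ∀ z, B.sharp (ι z) '' deltaAt ι D z ⊆ annihilator (deltaConstAt ι D z))
    (hf : f ∈ leafFunctions (E' := E') ι D V) (hg : g ∈ leafFunctions (E' := E') ι D V) :
    reducedBracket B ι D V f g ∈ leafFunctions (E' := E') ι D V := by
  intro z hz
  obtain ⟨m, rfl⟩ := Quotient.exists_rep z
  obtain ⟨U, F, G, hF, hG⟩ := hext.exists_at₂ (m := m) hf hg hz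
  exact ⟨m, rfl, U, _, (hF.bracket hι hD hB hG).toIsLocalExtension⟩

/-- This identity and those that follow are read off at a representative `m` of the leaf, from the
same identity in `P` for extensions on a common domain. -/
theorem reducedBracket_antisymm (hι : IsEmbeddedSubmanifold (E' := E') J ι)
    (hD : IsPoissonDistribution B ι D) (hext : HasLocalExtensionProperty (E' := E') ι D)
    (hB : ∀ z, B.sharp (ι z) '' deltaAt ι D z ⊆ annihilator (deltaConstAt ι D z))
    (hf : f ∈ leafFunctions (E' := E') ι D V) (hg : g ∈ leafFunctions (E' := E') ι D V) :
    reducedBracket B ι D V f g = -reducedBracket B ι D V g f := by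
  ext ⟨z, hz⟩
  obtain ⟨m, rfl⟩ := Quotient.exists_rep z
  obtain ⟨U, F, G, hF, hG⟩ := hext.exists_at₂ (m := m) hf hg hz
  exact (reducedBracket_apply hι hD hB hF hG hz).trans ((B.bracket_antisymm F G _).trans
    (congrArg Neg.neg (reducedBracket_apply hι hD hB hG hF hz).symm))

theorem reducedBracket_add_left (hι : IsEmbeddedSubmanifold (E' := E') J ι)
    (hD : IsPoissonDistribution B ι D) (hext : HasLocalExtensionProperty (E' := E') ι D)
    (hB : ∀ z, B.sharp (ι z) '' deltaAt ι D z ⊆ annihilator (deltaConstAt ι D z)) {h : V → ℝ}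
    (hf : f ∈ leafFunctions (E' := E') ι D V) (hg : g ∈ leafFunctions (E' := E') ι D V)
    (hh : h ∈ leafFunctions (E' := E') ι D V) :
    reducedBracket B ι D V (f + g) h = reducedBracket B ι D V f h + reducedBracket B ι D V g h := by
  ext ⟨z, hz⟩
  obtain ⟨m, rfl⟩ := Quotient.exists_rep z
  obtain ⟨U, F, G, H, hF, hG, hH⟩ := hext.exists_at₃ (m := m) hf hg hh hz
  exact (reducedBracket_apply hι hD hB (hF.add hG) hH hz).trans
    ((B.bracket_add_left H (hF.mdifferentiableAt hF.mem) (hG.mdifferentiableAt hG.mem)).trans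
      (congrArg₂ (· + ·) (reducedBracket_apply hι hD hB hF hH hz).symm
        (reducedBracket_apply hι hD hB hG hH hz).symm))

theorem reducedBracket_smul_left (hι : IsEmbeddedSubmanifold (E' := E') J ι)
    (hD : IsPoissonDistribution B ι D) (hext : HasLocalExtensionProperty (E' := E') ι D)
    (hB : ∀ z, B.sharp (ι z) '' deltaAt ι D z ⊆ annihilator (deltaConstAt ι D z)) (c : ℝ)
    (hf : f ∈ leafFunctions (E' := E') ι D V) (hg : g ∈ leafFunctions (E' := E') ι D V) :
    reducedBracket B ι D V (c • f) g = c • reducedBracket B ι D V f g := by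
  ext ⟨z, hz⟩
  obtain ⟨m, rfl⟩ := Quotient.exists_rep z
  obtain ⟨U, F, G, hF, hG⟩ := hext.exists_at₂ (m := m) hf hg hz
  exact (reducedBracket_apply hι hD hB (hF.const_smul c) hG hz).trans
    ((B.bracket_const_mul_left c G (hF.mdifferentiableAt hF.mem)).trans
      (congrArg (c * ·) (reducedBracket_apply hι hD hB hF hG hz).symm))

theorem reducedBracket_mul_left (hι : IsEmbeddedSubmanifold (E' := E') J ι)
    (hD : IsPoissonDistribution B ι D) (hext : HasLocalExtensionProperty (E' := E') ι D)
    (hB : ∀ z, B.sharp (ι z) '' deltaAt ι D z ⊆ annihilator (deltaConstAt ι D z)) {h : V → ℝ}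
    (hf : f ∈ leafFunctions (E' := E') ι D V) (hg : g ∈ leafFunctions (E' := E') ι D V)
    (hh : h ∈ leafFunctions (E' := E') ι D V) :
    reducedBracket B ι D V (f * g) h =
      f * reducedBracket B ι D V g h + g * reducedBracket B ι D V f h := by
  ext ⟨z, hz⟩
  obtain ⟨m, rfl⟩ := Quotient.exists_rep z
  obtain ⟨U, F, G, H, hF, hG, hH⟩ := hext.exists_at₃ (m := m) hf hg hh hz
  exact (reducedBracket_apply hι hD hB (hF.mul hG) hH hz).trans
    ((B.bracket_mul_left H (hF.mdifferentiableAt hF.mem) (hG.mdifferentiableAt hG.mem)).trans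
      (congrArg₂ (· + ·)
        (congrArg₂ (· * ·) (hF.eq m hz hF.mem).symm (reducedBracket_apply hι hD hB hG hH hz).symm)
        (congrArg₂ (· * ·) (hG.eq m hz hG.mem).symm
          (reducedBracket_apply hι hD hB hF hH hz).symm)))

/-- Nested brackets can be evaluated because the inner bracket of extensions is itself an invariant
extension of the inner reduced bracket. -/
theorem reducedBracket_jacobi (hι : IsEmbeddedSubmanifold (E' := E') J ι)
    (hD : IsPoissonDistribution B ι D) (hext : HasLocalExtensionProperty (E' := E') ι D)
    (hB : ∀ z, B.sharp (ι z) '' deltaAt ι D z ⊆ annihilator (deltaConstAt ι D z)) {h : V → ℝ}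
    (hf : f ∈ leafFunctions (E' := E') ι D V) (hg : g ∈ leafFunctions (E' := E') ι D V)
    (hh : h ∈ leafFunctions (E' := E') ι D V) :
    reducedBracket B ι D V f (reducedBracket B ι D V g h) +
      reducedBracket B ι D V g (reducedBracket B ι D V h f) +
      reducedBracket B ι D V h (reducedBracket B ι D V f g) = 0 := by
  ext ⟨z, hz⟩
  obtain ⟨m, rfl⟩ := Quotient.exists_rep z
  obtain ⟨U, F, G, H, hF, hG, hH⟩ := hext.exists_at₃ (m := m) hf hg hh hz
  exact (congrArg₂ (· + ·) (congrArg₂ (· + ·)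
      (reducedBracket_apply hι hD hB hF (hG.bracket hι hD hB hH) hz)
      (reducedBracket_apply hι hD hB hG (hH.bracket hι hD hB hF) hz))
      (reducedBracket_apply hι hD hB hH (hF.bracket hι hD hB hG) hz)).trans
    (B.jacobi U hF.isOpen F G H hF.smooth hG.smooth hH.smooth _ hF.mem)

/-- Sufficiency: if `B♯(Δ_z) ⊂ (Δ_z)_S°` for all `z`, then the reduced bracket is well defined. -/
theorem isPoissonReducible_of_sharp_image_subset (hι : IsEmbeddedSubmanifold (E' := E') J ι)
    (hD : IsPoissonDistribution B ι D) (hext : HasLocalExtensionProperty (E' := E') ι D)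
    (hB : ∀ z, B.sharp (ι z) '' deltaAt ι D z ⊆ annihilator (deltaConstAt ι D z)) :
    IsPoissonReducible (E' := E') B ι D := by
  have hanti : ∀ (V : Opens (LeafSpace (tangentPart (E' := E') ι D))) {f g : V → ℝ},
      f ∈ leafFunctions (E' := E') ι D V → g ∈ leafFunctions (E' := E') ι D V →
      reducedBracket B ι D V f g = -reducedBracket B ι D V g f := fun _ _ _ hf hg =>
    reducedBracket_antisymm hι hD hext hB hf hg
  refine ⟨fun V => LinearMap.mk₂ ℝ
    (fun f g => ⟨reducedBracket B ι D V f.1 g.1, reducedBracket_mem hι hD hext hB f.2 g.2⟩)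
    (fun f g h => Subtype.ext (reducedBracket_add_left hι hD hext hB f.2 g.2 h.2))
    (fun c f g => Subtype.ext (reducedBracket_smul_left hι hD hext hB c f.2 g.2))
    (fun f g h => Subtype.ext ?_) (fun c f g => Subtype.ext ?_), ?_, ?_, ?_, ?_, ?_⟩
  · change reducedBracket B ι D V f.1 (g + h).1 =
      reducedBracket B ι D V f.1 g.1 + reducedBracket B ι D V f.1 h.1
    rw [hanti V f.2 (g + h).2, hanti V f.2 g.2, hanti V f.2 h.2, ← neg_add]
    exact congrArg _ (reducedBracket_add_left hι hD hext hB g.2 h.2 f.2)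
  · change reducedBracket B ι D V f.1 (c • g).1 = c • reducedBracket B ι D V f.1 g.1
    rw [hanti V f.2 (c • g).2, hanti V f.2 g.2, smul_neg]
    exact congrArg _ (reducedBracket_smul_left hι hD hext hB c g.2 f.2)
  · intro V f h m hm U F H hF hH
    exact reducedBracket_apply hι hD hB hF hH hm
  · intro V f
    refine Subtype.ext ?_
    change reducedBracket B ι D V f.1 f.1 = 0
    exact self_eq_neg.1 (hanti V f.2 f.2)
  · intro V f g h
    exact Subtype.ext (reducedBracket_jacobi hι hD hext hB f.2 g.2 h.2)
  · intro V f g h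
    refine Subtype.ext ?_
    change reducedBracket B ι D V f.1 (g * h).1 =
      reducedBracket B ι D V f.1 g.1 * h.1 + g.1 * reducedBracket B ι D V f.1 h.1
    rw [hanti V f.2 (g * h).2, hanti V f.2 g.2, hanti V f.2 h.2]
    refine (congrArg _ (reducedBracket_mul_left hι hD hext hB g.2 h.2 f.2)).trans ?_
    ring
  · intro V V' hV f h
    refine Subtype.ext (funext fun ⟨z, hz⟩ => ?_)
    obtain ⟨m, rfl⟩ := Quotient.exists_rep z
    obtain ⟨U, F, H, hF, hH⟩ := hext.exists_at₂ (m := m) f.2 h.2 (hV hz)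
    exact (reducedBracket_apply hι hD hB hF hH (hV hz)).trans
      (reducedBracket_apply hι hD hB (hF.mono hV) (hH.mono hV) hz).symm

end ReducedBracket

/-! ### Necessity -/

section Necessity

variable {EP HP P : Type*} [NormedAddCommGroup EP] [NormedSpace ℝ EP]
  [TopologicalSpace HP] {J : ModelWithCorners ℝ EP HP}
  [TopologicalSpace P] [ChartedSpace HP P]
  {S : Type*} {ι : S → P} {D : ∀ s : S, Submodule ℝ (TangentSpace J (ι s))}
  {B : PoissonTensor J P} {U : Set P} {f g : P → ℝ} {z : S}

/-- If `D` is Poisson and nonzero at `z`, then the invariance of `{a g, f}` for all smooth `a`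
forces `{g, f}(z) = 0`, for invariant `f` and `g` with `g` constant on `S`. -/
theorem IsPoissonDistribution.bracket_eq_zero [IsManifold J ∞ P]
    (hD : IsPoissonDistribution B ι D) (hU : IsOpen U) (hz : ι z ∈ U)
    (hf : ContMDiffOn J 𝓘(ℝ, ℝ) ∞ f U) (hg : ContMDiffOn J 𝓘(ℝ, ℝ) ∞ g U)
    (hfk : KillsOn ι D f U) (hgk : KillsOn ι D g U) {c : ℝ} (hc : ∀ s, ι s ∈ U → g (ι s) = c)
    (hDz : D z ≠ ⊥) : B.bracket g f (ι z) = 0 := by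
  obtain ⟨v, hv, hv0⟩ := (D z).ne_bot_iff.1 hDz
  obtain ⟨O, a, hO, hzO, ha, hav⟩ := exists_contMDiffOn_mvfderiv_ne_zero (ι z) hv0
  -- Now `k` vanishes on `S`, so on `S` the differential of `a * k` is `a dk`, which `D` kills for
  -- every `a`.
  set k : P → ℝ := g - fun _ => c with hk
  have hUO : IsOpen (U ∩ O) := hU.inter hO
  have hzUO : ι z ∈ U ∩ O := ⟨hz, hzO⟩
  have hf' := hf.mono (inter_subset_left (s := U) (t := O))
  have ha' := ha.mono (inter_subset_right (s := U) (t := O))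
  have hk' : ContMDiffOn J 𝓘(ℝ, ℝ) ∞ k (U ∩ O) :=
    (hg.sub contMDiffOn_const).mono inter_subset_left
  have hkd : ∀ x ∈ U, mvfderiv J k x = mvfderiv J g x := fun x hx => by
    rw [hk, mvfderiv_sub (mdifferentiableAt_of_contMDiffOn hg hU hx) mdifferentiableAt_const,
      mvfderiv_const, sub_zero]
  have hk0 : ∀ s, ι s ∈ U → k (ι s) = 0 := fun s hs => sub_eq_zero.2 (hc s hs)
  have hfk' := hfk.mono (inter_subset_left (s := U) (t := O))
  have hkk : KillsOn ι D k (U ∩ O) := fun s hs w hw => by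
    rw [hkd _ hs.1, hgk s hs.1 w hw]
  have hak : KillsOn ι D (a * k) (U ∩ O) := fun s hs w hw => by
    rw [mvfderiv_mul (mdifferentiableAt_of_contMDiffOn ha' hUO hs)
      (mdifferentiableAt_of_contMDiffOn hk' hUO hs), hk0 s hs.1]
    simp [hkk s hs w hw]
  have h1 := hD _ hUO k f hk' hf' hkk hfk' z hzUO v hv
  have h2 := hD _ hUO (a * k) f (ha'.mul hk') hf' hak hfk' z hzUO v hv
  have hd : ∀ {h : P → ℝ}, ContMDiffOn J 𝓘(ℝ, ℝ) ∞ h (U ∩ O) →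
      MDifferentiableAt J 𝓘(ℝ, ℝ) h (ι z) := fun hh => mdifferentiableAt_of_contMDiffOn hh hUO hzUO
  have hbk := B.contMDiffOn_bracket hUO hk' hf'
  have hba := B.contMDiffOn_bracket hUO ha' hf'
  have heq : EqOn (B.bracket (a * k) f) (a * B.bracket k f + k * B.bracket a f) (U ∩ O) :=
    fun x hx => B.bracket_mul_left f (mdifferentiableAt_of_contMDiffOn ha' hUO hx)
      (mdifferentiableAt_of_contMDiffOn hk' hUO hx)
  -- Of the four terms of `d{a k, f} (v)` at `z`, only `{k, f} da (v)` survives: the others contain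
  -- `d{k, f} (v)`, `k` or `dk (v)`, all zero.
  rw [mvfderiv_congr_of_eqOn heq hUO hzUO, mvfderiv_add ((hd ha').mul (hd hbk))
    ((hd hk').mul (hd hba)), mvfderiv_mul (hd ha') (hd hbk), mvfderiv_mul (hd hk') (hd hba),
    hk0 z hz] at h2
  have h3 : B.bracket k f (ι z) * mvfderiv J a (ι z) v = 0 := by
    simpa [h1, hkk z hzUO v hv] using h2
  have h4 : B.bracket k f (ι z) = B.bracket g f (ι z) := by
    simp only [PoissonTensor.bracket, hkd _ hz]
  rw [← h4]
  exact (mul_eq_zero.1 h3).resolve_right hav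

variable {E' : Type*} [NormedAddCommGroup E'] [NormedSpace ℝ E'] [FiniteDimensional ℝ E']
  [TopologicalSpace S] [T2Space S] [SecondCountableTopology S] [ChartedSpace E' S]
  [IsManifold 𝓘(ℝ, E') ∞ S]

/-- Where `D_S` vanishes, invariant functions descend to the leaf space, and the reduced bracket
with a constant is zero. -/
theorem IsPoissonReducible.bracket_eq_zero (hred : IsPoissonReducible (E' := E') B ι D)
    (hι : IsEmbeddedSubmanifold (E' := E') J ι)
    (hreg : IsRegularDistribution (tangentPart (E' := E') ι D)) (hU : IsOpen U) (hz : ι z ∈ U)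
    (hf : ContMDiffOn J 𝓘(ℝ, ℝ) ∞ f U) (hg : ContMDiffOn J 𝓘(ℝ, ℝ) ∞ g U)
    (hfk : KillsOn ι D f U) (hgk : KillsOn ι D g U) {c : ℝ} (hc : ∀ s, ι s ∈ U → g (ι s) = c)
    (hDz : tangentPart (E' := E') ι D z = ⊥) : B.bracket f g (ι z) = 0 := by
  obtain ⟨br, hbr, -, -, hleib, -⟩ := hred
  -- An open set of one-point leaves, hence saturated: its image `V` is open in the leaf space
  -- although the trace of `U` need not be invariant.
  set A : Set S := ι ⁻¹' U ∩ {s | tangentPart (E' := E') ι D s = ⊥} with hA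
  have hAopen : IsOpen A :=
    (hU.preimage hι.isEmbedding.continuous).inter hreg.isClopen_setOf_eq_bot.isOpen
  have hpt : ∀ s ∈ A, ∀ s', leafProj (tangentPart (E' := E') ι D) s =
      leafProj (tangentPart (E' := E') ι D) s' → s' = s := fun s hs s' h =>
    ((hreg.isInvariantSet_singleton hs.2).mem_iff h).1 rfl
  have hsat : leafProj (tangentPart (E' := E') ι D) ⁻¹'
      (leafProj (tangentPart (E' := E') ι D) '' A) = A := by
    refine Subset.antisymm ?_ (subset_preimage_image _ _)
    rintro s ⟨s', hs', h⟩
    rwa [hpt s' hs' s h]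
  have hAinv : IsInvariantSet (tangentPart (E' := E') ι D) A := by
    rw [← hsat]
    exact isInvariantSet_preimage_leafProj _
  have hVopen : IsOpen (leafProj (tangentPart (E' := E') ι D) '' A) := by
    refine (isQuotientMap_quotient_mk'
      (s := leafSetoid (tangentPart (E' := E') ι D))).isOpen_preimage.1 ?_
    exact hsat.symm ▸ hAopen
  let V : Opens (LeafSpace (tangentPart (E' := E') ι D)) := ⟨_, hVopen⟩
  have hVA : ∀ s, leafProj (tangentPart (E' := E') ι D) s ∈ V ↔ s ∈ A := Set.ext_iff.1 hsat
  obtain ⟨O, hO, hOA⟩ := hι.isEmbedding.isInducing.isOpen_iff.1 hAopen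
  have hpre : ι ⁻¹' (U ∩ O) = A := by
    rw [preimage_inter, hOA]
    exact inter_eq_right.2 inter_subset_left
  -- The representative `out` is the only point of its leaf, so `φ ∘ π = f ∘ ι` on `A`.
  let φ : V → ℝ := fun w => f (ι w.1.out)
  have hφ : ∀ (s : S) (hs : leafProj (tangentPart (E' := E') ι D) s ∈ V), φ ⟨_, hs⟩ = f (ι s) :=
    fun s hs => congrArg (fun t => f (ι t)) (hpt s ((hVA s).1 hs) _ (Quotient.out_eq _).symm)
  have hF : ∀ s ∈ A, IsInvariantExtension ι D V φ s (U ∩ O) f := fun s hs =>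
    { isOpen := hU.inter hO
      mem := hpre.symm.subset hs
      invariant := hpre.symm ▸ hAinv
      smooth := hf.mono inter_subset_left
      eq := fun s hs _ => hφ s hs
      kills := fun s _ hs => hfk s hs.1 }
  have hzA : z ∈ A := ⟨hz, hDz⟩
  have hG : IsInvariantExtension ι D V
      (algebraMap ℝ (leafFunctions (E' := E') ι D V) c).1 z (U ∩ O) g :=
    { isOpen := hU.inter hO
      mem := hpre.symm.subset hzA
      invariant := hpre.symm ▸ hAinv
      smooth := hg.mono inter_subset_left
      eq := fun s _ hs => (hc s hs.1).symm
      kills := fun s _ hs => hgk s hs.1 }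
  have hφmem : φ ∈ leafFunctions (E' := E') ι D V := by
    rintro _ ⟨s, hs, rfl⟩
    exact ⟨s, rfl, U ∩ O, f, (hF s hs).toIsLocalExtension⟩
  -- Leibniz applied to `1 * 1` gives `{φ, 1} = {φ, 1} + {φ, 1}`.
  have hone : br V ⟨φ, hφmem⟩ 1 = 0 := by
    have h := hleib V ⟨φ, hφmem⟩ 1 1
    rw [mul_one, mul_one, one_mul] at h
    exact left_eq_add.1 h
  have hconst : br V ⟨φ, hφmem⟩ (algebraMap ℝ (leafFunctions (E' := E') ι D V) c) = 0 := by
    rw [Algebra.algebraMap_eq_smul_one, map_smul, hone, smul_zero]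
  have h := hbr V ⟨φ, hφmem⟩ (algebraMap ℝ _ c) z ((hVA z).2 hzA) (U ∩ O) f g (hF z hzA) hG
  rw [hconst] at h
  exact h.symm

/-- Necessity: a Poisson reducible `(P, B, D, S)` satisfies `B♯(Δ_z) ⊂ (Δ_z)_S°`. -/
theorem IsPoissonReducible.sharp_image_subset [IsManifold J ∞ P]
    (hred : IsPoissonReducible (E' := E') B ι D) (hι : IsEmbeddedSubmanifold (E' := E') J ι)
    (hD : IsPoissonDistribution B ι D)
    (hreg : IsRegularDistribution (tangentPart (E' := E') ι D)) (z : S) :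
    B.sharp (ι z) '' deltaAt ι D z ⊆ annihilator (deltaConstAt ι D z) := by
  rintro _ ⟨_, ⟨U, f, hU, hz, hf, hfk, rfl⟩, rfl⟩ _ ⟨U', g, hU', hz', hg, hgk, ⟨c, hc⟩, rfl⟩
  change B.bracket g f (ι z) = 0
  have hf' := hf.mono (inter_subset_left (s := U) (t := U'))
  have hg' := hg.mono (inter_subset_right (s := U) (t := U'))
  have hfk' := hfk.mono (inter_subset_left (s := U) (t := U'))
  have hgk' := hgk.mono (inter_subset_right (s := U) (t := U'))
  -- The split is on `D z`, not on its tangent part: the first argument needs any nonzero vector of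
  -- `D z`, tangent to `S` or not. If `D z = ⊥`, the tangent part is the kernel of the immersion,
  -- which is trivial.
  by_cases hDz : D z = ⊥
  · rw [B.bracket_antisymm, neg_eq_zero]
    refine hred.bracket_eq_zero hι hreg (hU.inter hU') ⟨hz, hz'⟩ hf' hg' hfk' hgk'
      (fun s hs => hc s hs.2) ?_
    rw [tangentPart, hDz]
    exact LinearMap.ker_eq_bot.2 (hι.immersion z)
  · exact hD.bracket_eq_zero (hU.inter hU') ⟨hz, hz'⟩ hf' hg' hfk' hgk'
      (fun s hs => hc s hs.2) hDz

end Necessity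

end PoissonReduction

theorem theorem3p4
    {E : Type*} [NormedAddCommGroup E] [NormedSpace ℝ E] [FiniteDimensional ℝ E]
    {Q : Type*} [TopologicalSpace Q] [T2Space Q] [SecondCountableTopology Q]
    [ChartedSpace E Q] [IsManifold 𝓘(ℝ, E) ∞ Q]
    {E' : Type*} [NormedAddCommGroup E'] [NormedSpace ℝ E'] [FiniteDimensional ℝ E']
    {W : Type*} [TopologicalSpace W] [T2Space W] [SecondCountableTopology W]
    [ChartedSpace E' W] [IsManifold 𝓘(ℝ, E') ∞ W]
    (K : HorizontalSplitting E Q) (S : CHSystem E Q E' W)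
    (hW : S.IsControllabilitySubmanifold K)
    (D : ∀ w : W, Submodule ℝ (TangentSpace (cotModel E) (S.ι w)))
    (hD : S.IsControllabilityDistribution K D)
    (hsmooth : IsSmoothDistribution (tangentPart (E' := E') S.ι D))
    (hregular : IsRegularDistribution (tangentPart (E' := E') S.ι D))
    (hintegrable : IsIntegrableDistribution (tangentPart (E' := E') S.ι D))
    (hext : HasLocalExtensionProperty (E' := E') S.ι D) :
    S.IsPoissonReducibleBy D ↔
      ∀ z : W, S.B.sharp (S.ι z) '' deltaAt S.ι D z ⊆ annihilator (deltaConstAt S.ι D z) := by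
  exact ⟨fun hred => IsPoissonReducible.sharp_image_subset hred S.submanifold hD.poisson hregular,
    isPoissonReducible_of_sharp_image_subset S.submanifold hD.poisson hext⟩
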